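/- Let $\Sigma^*$ be the set of finite sequences over $\{0,1\}$ and define length-preserving permutations $a,b,c,d$ of $\Sigma^*$ recursively (each fixing the empty sequence) by $$a(x\sigma)=(1-x)\sigma,\quad b(0\sigma)=0a(\sigma),\ b(1\sigma)=1c(\sigma),\quad c(0\sigma)=0a(\sigma),\ c(1\sigma)=1d(\sigma),\quad d(0\sigma)=0\sigma,\ d(1\sigma)=1b(\sigma).$$ Let $G=\langle a,b,c,d\rangle$ (Grigorchuk's $2$-group), let $H$ be the normal closure of $\{1,b,c,d\}$ in $G$, and let $\psi:H\to G\times G$, $h\mapsto(h_0,h_1)$, be the homomorphism determined by $h(0\sigma)=0h_0(\sigma)$ and $h(1\sigma)=1h_1(\sigma)$ for all $\sigma\in\Sigma^*$. A weight is a function $\omega:\{a,b,c,d\}\to(0,\infty)$; it is triangular if $\omega(x)\le\omega(y)+\omega(z)$ whenever $\{x,y,z\}=\{b,c,d\}$. For a weight $\omega$ and $g\in G$ put $$\partial_\omega(g)=\min\{\omega(s_1)+\dots+\omega(s_n)\mid n\ge 0,\ s_i\in\{a,b,c,d\},\ s_1\cdots s_n=g\}.$$ **Proposition.** There are a triangular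 weight $\omega$ and constants $K\ge0$ and $\eta<4$ such that every $h\in H$, with $\psi(h)=(h_0,h_1)$, satisfies $$\partial_\omega(h)\le\eta\,\max\{\partial_\omega(h_0),\partial_\omega(h_1)\}+K.$$ Moreover one may take $\omega(a)=1$, $\omega(b)=3.33$, $\omega(c)=2.8$, $\omega(d)=1.06$ and $\eta=3.83414$. -/

import Mathlib

namespace Grigorchuk

/-- The four letters indexing the generating set `S = {a, b, c, d}`. -/
inductive Gen : Type
  | a | b | c | d
  deriving DecidableEq

instance : Fintype Gen := ⟨{.a, .b, .c, .d}, by rintro (_ | _ | _ | _) <;> decide⟩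

instance : Nonempty Gen := ⟨.a⟩

/-- The action of the generators on finite binary sequences (`false` is the letter `0`,
`true` is the letter `1`):
`a(xσ) = (1-x)σ`, `b(0σ) = 0a(σ)`, `b(1σ) = 1c(σ)`, `c(0σ) = 0a(σ)`, `c(1σ) = 1d(σ)`,
`d(0σ) = 0σ`, `d(1σ) = 1b(σ)`; the empty sequence is fixed. -/
def act : Gen → List Bool → List Bool
  | _, [] => []
  | .a, x :: σ => (!x) :: σ
  | .b, false :: σ => false :: act .a σ
  | .b, true :: σ => true :: act .c σ
  | .c, false :: σ => false :: act .a σ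
  | .c, true :: σ => true :: act .d σ
  | .d, false :: σ => false :: σ
  | .d, true :: σ => true :: act .b σ

theorem act_involutive (s : Gen) : Function.Involutive (act s) := by
  intro σ
  induction σ generalizing s with
  | nil => cases s <;> simp [act]
  | cons x σ ih => cases s <;> cases x <;> simp [act, ih]

/-- The generators as permutations of the set of finite binary sequences. -/
def genPerm (s : Gen) : Equiv.Perm (List Bool) := (act_involutive s).toPerm

@[simp] theorem genPerm_apply (s : Gen) (σ : List Bool) : genPerm s σ = act s σ := rfl

theorem genPerm_inv (s : Gen) : (genPerm s)⁻¹ = genPerm s := by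
  ext1 σ
  rw [Equiv.Perm.inv_eq_iff_eq]
  exact (act_involutive s σ).symm

/-- The Grigorchuk `2`-group `G = ⟨a, b, c, d⟩`. -/
def G : Subgroup (Equiv.Perm (List Bool)) := Subgroup.closure (Set.range genPerm)

theorem genPerm_mem (s : Gen) : genPerm s ∈ G := Subgroup.subset_closure ⟨s, rfl⟩

/-- The generators as elements of `G`. -/
def gen (s : Gen) : G := ⟨genPerm s, genPerm_mem s⟩

/-- `H` is the normal closure in `G` of `V = {1, b, c, d}`. -/
def H : Subgroup G := Subgroup.normalClosure {1, gen .b, gen .c, gen .d}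

/-- The permutation acting by `0σ ↦ 0 g₀(σ)`, `1σ ↦ 1 g₁(σ)` and fixing the empty sequence. -/
def pairFun (g₀ g₁ : Equiv.Perm (List Bool)) : List Bool → List Bool
  | [] => []
  | false :: σ => false :: g₀ σ
  | true :: σ => true :: g₁ σ

/-- The homomorphism `G × G → Sym(Σ*)` sending `(g₀, g₁)` to the permutation
`0σ ↦ 0 g₀(σ)`, `1σ ↦ 1 g₁(σ)`. -/
def pairHom : G × G →* Equiv.Perm (List Bool) where
  toFun p :=
    { toFun := pairFun p.1 p.2
      invFun := pairFun (p.1 : Equiv.Perm (List Bool))⁻¹ (p.2 : Equiv.Perm (List Bool))⁻¹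
      left_inv := by rintro (_ | ⟨_ | _, σ⟩) <;> simp [pairFun]
      right_inv := by rintro (_ | ⟨_ | _, σ⟩) <;> simp [pairFun] }
  map_one' := by ext1 σ; rcases σ with (_ | ⟨_ | _, σ⟩) <;> simp [pairFun]
  map_mul' p q := by ext1 σ; rcases σ with (_ | ⟨_ | _, σ⟩) <;> simp [pairFun]

@[simp] theorem pairHom_nil (p : G × G) : pairHom p [] = [] := rfl
@[simp] theorem pairHom_false (p : G × G) (σ : List Bool) :
    pairHom p (false :: σ) = false :: (p.1 : Equiv.Perm (List Bool)) σ := rfl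
@[simp] theorem pairHom_true (p : G × G) (σ : List Bool) :
    pairHom p (true :: σ) = true :: (p.2 : Equiv.Perm (List Bool)) σ := rfl

theorem pairHom_injective : Function.Injective pairHom := by
  intro p q h
  refine Prod.ext (Subtype.ext (Equiv.ext fun σ => ?_)) (Subtype.ext (Equiv.ext fun σ => ?_))
  · have := congrArg (fun f : Equiv.Perm (List Bool) => f (false :: σ)) h
    simpa using this
  · have := congrArg (fun f : Equiv.Perm (List Bool) => f (true :: σ)) h
    simpa using this

theorem pairHom_b : pairHom (gen .a, gen .c) = genPerm .b := by
  ext1 σ; rcases σ with (_ | ⟨_ | _, σ⟩) <;> simp [gen, act]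

theorem pairHom_c : pairHom (gen .a, gen .d) = genPerm .c := by
  ext1 σ; rcases σ with (_ | ⟨_ | _, σ⟩) <;> simp [gen, act]

theorem pairHom_d : pairHom (1, gen .b) = genPerm .d := by
  ext1 σ; rcases σ with (_ | ⟨_ | _, σ⟩) <;> simp [gen, act]

theorem conj_a_pairHom (p : G × G) :
    genPerm .a * pairHom p * (genPerm .a)⁻¹ = pairHom (p.2, p.1) := by
  rw [genPerm_inv]
  ext1 σ; rcases σ with (_ | ⟨_ | _, σ⟩) <;> simp [act]

theorem conj_genPerm_mem_range (s : Gen) {x : Equiv.Perm (List Bool)}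
    (hx : x ∈ pairHom.range) : genPerm s * x * (genPerm s)⁻¹ ∈ pairHom.range := by
  cases s with
  | a => obtain ⟨p, rfl⟩ := hx; exact ⟨_, (conj_a_pairHom p).symm⟩
  | b =>
    have h : genPerm .b ∈ pairHom.range := ⟨_, pairHom_b⟩
    exact mul_mem (mul_mem h hx) (inv_mem h)
  | c =>
    have h : genPerm .c ∈ pairHom.range := ⟨_, pairHom_c⟩
    exact mul_mem (mul_mem h hx) (inv_mem h)
  | d =>
    have h : genPerm .d ∈ pairHom.range := ⟨_, pairHom_d⟩
    exact mul_mem (mul_mem h hx) (inv_mem h)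

theorem conj_mem_range {g : Equiv.Perm (List Bool)} (hg : g ∈ G) :
    ∀ x ∈ pairHom.range, g * x * g⁻¹ ∈ pairHom.range := by
  induction hg using Subgroup.closure_induction'' with
  | one => intro x hx; simpa using hx
  | mem g hg => obtain ⟨s, rfl⟩ := hg; exact fun x hx => conj_genPerm_mem_range s hx
  | inv_mem g hg =>
    obtain ⟨s, rfl⟩ := hg
    intro x hx
    rw [genPerm_inv s]
    exact conj_genPerm_mem_range s hx
  | mul g k _ _ ihg ihk =>
    intro x hx
    have := ihg _ (ihk x hx)
    simpa [mul_assoc] using this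

theorem H_le_comap_range : H ≤ pairHom.range.comap G.subtype := by
  have hn : (pairHom.range.comap G.subtype).Normal :=
    ⟨fun x hx g => conj_mem_range g.2 _ hx⟩
  refine Subgroup.normalClosure_le_normal ?_
  rintro x (rfl | rfl | rfl | rfl)
  · exact one_mem _
  · exact ⟨_, pairHom_b⟩
  · exact ⟨_, pairHom_c⟩
  · exact ⟨_, pairHom_d⟩

/-- The homomorphism `ψ : H → G × G`, `g ↦ (g₀, g₁)`, where `0 g₀(σ) = g(0σ)` and
`1 g₁(σ) = g(1σ)` (see `psi_fst` and `psi_snd`). -/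
noncomputable def psi : H →* G × G :=
  (MonoidHom.ofInjective pairHom_injective).symm.toMonoidHom.comp
    ((G.subtype.comp H.subtype).codRestrict pairHom.range fun h => H_le_comap_range h.2)

theorem pairHom_psi (h : H) : pairHom (psi h) = ((h : G) : Equiv.Perm (List Bool)) := by
  have := (MonoidHom.ofInjective pairHom_injective).apply_symm_apply
    ((G.subtype.comp H.subtype).codRestrict pairHom.range (fun h => H_le_comap_range h.2) h)
  exact congrArg Subtype.val this

theorem psi_fst (h : H) (σ : List Bool) :
    false :: ((psi h).1 : Equiv.Perm (List Bool)) σ =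
      ((h : G) : Equiv.Perm (List Bool)) (false :: σ) := by
  rw [← pairHom_psi h, pairHom_false]

theorem psi_snd (h : H) (σ : List Bool) :
    true :: ((psi h).2 : Equiv.Perm (List Bool)) σ =
      ((h : G) : Equiv.Perm (List Bool)) (true :: σ) := by
  rw [← pairHom_psi h, pairHom_true]

theorem psi_injective : Function.Injective psi := by
  intro h k e
  have := congrArg pairHom e
  rw [pairHom_psi, pairHom_psi] at this
  exact Subtype.ext (Subtype.ext this)

/-- The element of `G` represented by a word over `S`. -/
def eval (w : List Gen) : G := (w.map gen).prod

/-- The weight of a word over `S`. -/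
def wordWeight (ω : Gen → ℝ) (w : List Gen) : ℝ := (w.map ω).sum

/-- A weight on `(G, S)` is a strictly positive function on `S`. -/
def IsWeight (ω : Gen → ℝ) : Prop := ∀ s, 0 < ω s

/-- A weight is triangular if `ω(x) ≤ ω(y) + ω(z)` for every ordering `(x, y, z)` of
`{b, c, d}`. -/
def IsTriangular (ω : Gen → ℝ) : Prop :=
  ω .b ≤ ω .c + ω .d ∧ ω .c ≤ ω .b + ω .d ∧ ω .d ≤ ω .b + ω .c

/-- The norm `∂_ω(g) = min {ω(s₁) + ⋯ + ω(sₙ) | s₁ ⋯ sₙ = g}` on `G` induced by `ω`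
(for a weight `ω` the infimum is a minimum, see `isLeast_partial`). -/
noncomputable def partialNorm (ω : Gen → ℝ) (g : G) : ℝ :=
  sInf {t | ∃ w : List Gen, eval w = g ∧ wordWeight ω w = t}

theorem exists_eval (g : G) : ∃ w : List Gen, eval w = g := by
  have key : ∀ x ∈ G, ∃ w : List Gen, ((eval w : G) : Equiv.Perm (List Bool)) = x := by
    intro x hx
    induction hx using Subgroup.closure_induction'' with
    | one => exact ⟨[], rfl⟩
    | mem x hx => obtain ⟨s, rfl⟩ := hx; exact ⟨[s], by simp [eval, gen]⟩
    | inv_mem x hx =>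
      obtain ⟨s, rfl⟩ := hx
      exact ⟨[s], by rw [genPerm_inv s]; simp [eval, gen]⟩
    | mul x y _ _ hx hy =>
      obtain ⟨u, rfl⟩ := hx
      obtain ⟨v, rfl⟩ := hy
      exact ⟨u ++ v, by simp [eval]⟩
  obtain ⟨w, hw⟩ := key g g.2
  exact ⟨w, Subtype.ext hw⟩

/-- For a weight `ω`, the value `∂_ω(g)` is attained. -/
theorem isLeast_partial {ω : Gen → ℝ} (hω : IsWeight ω) (g : G) :
    IsLeast {t | ∃ w : List Gen, eval w = g ∧ wordWeight ω w = t} (partialNorm ω g) := by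
  obtain ⟨w₀, hw₀⟩ := exists_eval g
  obtain ⟨m, hm, hmω⟩ : ∃ m : ℝ, 0 < m ∧ ∀ s, m ≤ ω s := by
    obtain ⟨s, hs⟩ := Finite.exists_min ω
    exact ⟨ω s, hω s, hs⟩
  have hlen : ∀ w : List Gen, m * w.length ≤ wordWeight ω w := by
    intro w
    induction w with
    | nil => simp [wordWeight]
    | cons s w ih =>
      have := hmω s
      simp only [wordWeight, List.map_cons, List.sum_cons, List.length_cons] at ih ⊢
      push_cast
      linarith
  have hfin : {w : List Gen | eval w = g ∧ wordWeight ω w ≤ wordWeight ω w₀}.Finite := by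
    refine (List.finite_length_le Gen ⌊wordWeight ω w₀ / m⌋₊).subset ?_
    rintro w ⟨-, hw⟩
    refine Nat.le_floor ?_
    rw [le_div_iff₀ hm]
    linarith [hlen w]
  obtain ⟨w₁, ⟨h1, h2⟩, h3⟩ :=
    Set.exists_min_image _ (wordWeight ω) hfin ⟨w₀, hw₀, le_rfl⟩
  have hl : IsLeast {t | ∃ w : List Gen, eval w = g ∧ wordWeight ω w = t}
      (wordWeight ω w₁) := by
    refine ⟨⟨w₁, h1, rfl⟩, ?_⟩
    rintro t ⟨w, hw, rfl⟩
    rcases le_total (wordWeight ω w) (wordWeight ω w₀) with h | h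
    · exact h3 w ⟨hw, h⟩
    · exact h2.trans h
  rw [partialNorm, hl.csInf_eq]
  exact hl

end Grigorchuk

namespace Grigorchuk

/-! ### A sound test for the word problem -/

/-! Since `psi` is injective, `h` may be rebuilt from its coordinates. A product of moves `x` or `a
x a` with `x ∈ {b, c, d}` lies in `H`; each factor costs its letter and one `a`, because adjacent
`a`s cancel (`exists_word_prod_toH`), and the coordinates of the product are explicit words
(`psi_prod_toH`). The task is to find a cheap product whose coordinates agree with `h₀, h₁` up to a
finite set.

Near-minimal words `a x₁ a x₂ ⋯` for `h₀` and `h₁` are read from the left by a finite transducer.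
Its state is a pair of elements of `⟨a, d⟩`; each rule consumes a block from one or both words,
emits moves and changes state, by an identity checked in `G × G`. An amortized count with a
potential on states charges one word at rate 1.46 and the other at 2.37. Which word runs out first
is not known in advance, so every rule must be affordable with the rates assigned in either order.
Once one word is exhausted, the rest of the other is lifted alone at rate 2.37 by moves that disturb
the exhausted coordinate only within the finite group `⟨a, d⟩` (`exists_single_lift`,
`exists_pair_lift`). The total rate is at most 1.46 + 2.37 = 3.83 times the larger norm.

What is left of `h` has both coordinates in a fixed finite set, so by injectivity of `psi` its norm
is bounded (`exists_bound_of_finite`). -/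

theorem gen_mul_self (s : Gen) : gen s * gen s = 1 :=
  Subtype.ext (Equiv.ext fun σ => act_involutive s σ)

theorem gen_inv (s : Gen) : (gen s)⁻¹ = gen s :=
  inv_eq_of_mul_eq_one_left (gen_mul_self s)

@[simp] theorem eval_nil : eval [] = 1 := rfl

@[simp] theorem eval_cons (s : Gen) (w : List Gen) : eval (s :: w) = gen s * eval w := by
  simp [eval]

@[simp] theorem eval_append (u v : List Gen) : eval (u ++ v) = eval u * eval v := by
  simp [eval]

theorem eval_reverse (w : List Gen) : eval w.reverse = (eval w)⁻¹ := by
  induction w with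
  | nil => simp
  | cons s w ih => simp [ih, gen_inv]

/-- Writes `w` as `(u, v) aᵖ`, returning `(u, v, p)`. -/
def split : List Gen → List Gen × List Gen × Bool
  | [] => ([], [], false)
  | .a :: w => ((split w).2.1, (split w).1, !(split w).2.2)
  | .b :: w => (.a :: (split w).1, .c :: (split w).2.1, (split w).2.2)
  | .c :: w => (.a :: (split w).1, .d :: (split w).2.1, (split w).2.2)
  | .d :: w => ((split w).1, .b :: (split w).2.1, (split w).2.2)

theorem genPerm_a_mul_pairHom (p : G × G) :
    genPerm .a * pairHom p = pairHom (p.2, p.1) * genPerm .a := by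
  rw [← conj_a_pairHom]; simp

theorem split_spec (w : List Gen) :
    ((eval w : G) : Equiv.Perm (List Bool)) =
      pairHom (eval (split w).1, eval (split w).2.1) *
        (if (split w).2.2 then genPerm .a else 1) := by
  induction w with
  | nil => simp [split, ← Prod.one_eq_mk]
  | cons s w ih =>
    have hs : ((eval (s :: w) : G) : Equiv.Perm (List Bool)) =
        genPerm s * ((eval w : G) : Equiv.Perm (List Bool)) := by simp [gen]
    rw [hs, ih]
    cases s with
    | a =>
      rw [← mul_assoc, genPerm_a_mul_pairHom, mul_assoc]
      have ha : genPerm .a * genPerm .a = 1 := congrArg Subtype.val (gen_mul_self .a)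
      cases h : (split w).2.2 <;> simp [split, h, ha]
    | b => rw [← pairHom_b, ← mul_assoc, ← map_mul]; simp only [split, eval_cons, Prod.mk_mul_mk]; rfl
    | c => rw [← pairHom_c, ← mul_assoc, ← map_mul]; simp only [split, eval_cons, Prod.mk_mul_mk]; rfl
    | d =>
      rw [← pairHom_d, ← mul_assoc, ← map_mul]
      simp only [split, eval_cons, Prod.mk_mul_mk, one_mul]; rfl

theorem act_b_c_d (σ : List Bool) : act .b (act .c (act .d σ)) = σ := by
  -- Below the letter `1` the recursion replaces `b, c, d` by `c, d, b`, so the three cyclic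
  -- rotations need a simultaneous induction.
  suffices h : ∀ σ : List Bool, act .b (act .c (act .d σ)) = σ ∧
      act .c (act .d (act .b σ)) = σ ∧ act .d (act .b (act .c σ)) = σ from (h σ).1
  intro σ
  induction σ with
  | nil => simp [act]
  | cons x σ ih =>
    cases x
    · simp [act, act_involutive .a σ]
    · simp [act, ih]

/-- The product of two distinct letters among `b, c, d`, if they are such. -/
def third : Gen → Gen → Option Gen
  | .b, .c => some .d
  | .c, .b => some .d
  | .b, .d => some .c
  | .d, .b => some .c
  | .c, .d => some .b
  | .d, .c => some .b
  | _, _ => none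

theorem gen_mul_gen_of_third {s t u : Gen} (h : third s t = some u) :
    gen s * gen t = gen u := by
  have hbcd : gen .b * gen .c * gen .d = 1 :=
    Subtype.ext (Equiv.ext fun σ => act_b_c_d σ)
  have hbc : gen .b * gen .c = gen .d := by
    rw [eq_inv_of_mul_eq_one_left hbcd, gen_inv]
  have hcb : gen .c * gen .b = gen .d := by
    rw [← gen_inv .d, ← hbc, mul_inv_rev, gen_inv, gen_inv]
  have hbd : gen .b * gen .d = gen .c := by
    rw [← hbc, ← mul_assoc, gen_mul_self, one_mul]
  have hdb : gen .d * gen .b = gen .c := by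
    rw [← hcb, mul_assoc, gen_mul_self, mul_one]
  have hcd : gen .c * gen .d = gen .b := by
    rw [← hcb, ← mul_assoc, gen_mul_self, one_mul]
  have hdc : gen .d * gen .c = gen .b := by
    rw [← hbc, mul_assoc, gen_mul_self, mul_one]
  cases s <;> cases t <;> simp only [third, Option.some.injEq, reduceCtorEq] at h <;> subst h <;>
    assumption

/-- Prepends a letter to a word and contracts it with the first letter if possible. -/
def push (s : Gen) : List Gen → List Gen
  | [] => [s]
  | t :: w => if s = t then w else
    match third s t with
    | some u => u :: w
    | none => s :: t :: w

theorem eval_push (s : Gen) (w : List Gen) : eval (push s w) = gen s * eval w := by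
  cases w with
  | nil => rfl
  | cons t w =>
    by_cases h : s = t
    · subst h; simp [push, ← mul_assoc, gen_mul_self]
    · cases hu : third s t with
      | none => simp [push, h, hu]
      | some u => simp [push, h, hu, ← gen_mul_gen_of_third hu, mul_assoc]

theorem eval_foldr_push (w : List Gen) : eval (w.foldr push []) = eval w := by
  induction w with
  | nil => rfl
  | cons s w ih => simp [eval_push, ih]

/-- A sufficient test for `eval w = 1`, descending `n` levels of the tree. -/
def isTrivial : ℕ → List Gen → Bool
  | 0, w => (w.foldr push []).isEmpty
  | n + 1, w =>
    (w.foldr push []).isEmpty ||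
      (!(split (w.foldr push [])).2.2 && isTrivial n (split (w.foldr push [])).1 &&
        isTrivial n (split (w.foldr push [])).2.1)

theorem eval_eq_one_of_isTrivial {n : ℕ} {w : List Gen} (h : isTrivial n w = true) :
    eval w = 1 := by
  induction n generalizing w with
  | zero =>
    rw [← eval_foldr_push, List.isEmpty_iff.mp h]; rfl
  | succ n ih =>
    simp only [isTrivial, Bool.or_eq_true, Bool.and_eq_true, Bool.not_eq_true'] at h
    rw [← eval_foldr_push]
    rcases h with h | ⟨⟨h₀, h₁⟩, h₂⟩
    · rw [List.isEmpty_iff.mp h]; rfl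
    · refine Subtype.ext ?_
      rw [split_spec, ih h₁, ih h₂, h₀, ← Prod.one_eq_mk]; simp

/-! ### Weights of letters -/

/-- The letters `b, c, d`. -/
inductive Letter : Type
  | b | c | d
  deriving DecidableEq

instance : Fintype Letter := ⟨{.b, .c, .d}, by rintro (_ | _ | _) <;> decide⟩

/-- A letter as a generator. -/
def Letter.toGen : Letter → Gen
  | .b => .b
  | .c => .c
  | .d => .d

/-- The weight in hundredths. -/
def centiWeight : Gen → ℕ
  | .a => 100
  | .b => 333
  | .c => 280
  | .d => 106

/-- The word `a x₁ a x₂ ⋯ a xₙ`. -/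
def syllables : List Letter → List Gen
  | [] => []
  | x :: xs => .a :: x.toGen :: syllables xs

@[simp] theorem syllables_append (xs ys : List Letter) :
    syllables (xs ++ ys) = syllables xs ++ syllables ys := by
  induction xs with
  | nil => rfl
  | cons x xs ih => simp [syllables, ih]

/-- The weight of `a x₁ a x₂ ⋯ a xₙ` in hundredths. -/
def syllableWeight : List Letter → ℕ
  | [] => 0
  | x :: xs => 100 + centiWeight x.toGen + syllableWeight xs

@[simp] theorem syllableWeight_append (xs ys : List Letter) :
    syllableWeight (xs ++ ys) = syllableWeight xs + syllableWeight ys := by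
  induction xs with
  | nil => simp [syllableWeight]
  | cons x xs ih => simp [syllableWeight, ih, add_assoc]

/-- This is where triangularity of the weight enters: merging two adjacent letters never raises the
weight. -/
theorem exists_third_letter (x y : Letter) (h : x ≠ y) :
    ∃ z : Letter, gen x.toGen * gen y.toGen = gen z.toGen ∧
      centiWeight z.toGen ≤ centiWeight x.toGen + centiWeight y.toGen := by
  have key : ∀ x y : Letter, x ≠ y → ∃ z : Letter,
      third x.toGen y.toGen = some z.toGen ∧
      centiWeight z.toGen ≤ centiWeight x.toGen + centiWeight y.toGen := by decide
  obtain ⟨z, hz, hw⟩ := key x y h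
  exact ⟨z, gen_mul_gen_of_third hz, hw⟩

/-- `1` or `a`. -/
def aIf (r : Bool) : G := if r then gen .a else 1

/-- Every word can be brought to the form `a^r (a x₁ ⋯ a xₙ) a^t` at bounded extra weight. -/
theorem exists_syllables (v : List Gen) :
    ∃ (r : Bool) (xs : List Letter) (t : Bool),
      eval v = aIf r * eval (syllables xs) * aIf t ∧
      syllableWeight xs ≤ (v.map centiWeight).sum + (if r then 100 else 0) := by
  have haa := gen_mul_self .a
  have haa' : ∀ g : G, gen .a * (gen .a * g) = g := fun g => by rw [← mul_assoc, haa, one_mul]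
  induction v with
  | nil => exact ⟨false, [], false, by simp [aIf, syllables], by simp [syllableWeight]⟩
  | cons s v ih =>
    obtain ⟨r, xs, t, hv, hw⟩ := ih
    have letter : ∀ x : Letter, s = x.toGen → ∃ (r : Bool) (xs : List Letter) (t : Bool),
        eval (s :: v) = aIf r * eval (syllables xs) * aIf t ∧
        syllableWeight xs ≤ ((s :: v).map centiWeight).sum + (if r then 100 else 0) := by
      rintro x rfl
      cases r with
      -- Inserting `a a` in front of `x` adds one counted `a`; the allowance of 100 attached to `r =
      -- true` pays for it.
      | false =>
        refine ⟨true, x :: xs, t, ?_, ?_⟩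
        · simp [hv, aIf, syllables, haa', mul_assoc]
        · simp [syllableWeight] at hw ⊢; omega
      | true =>
        cases xs with
        | nil =>
          refine ⟨true, [x], !t, ?_, ?_⟩
          · cases t <;> simp [hv, aIf, syllables, haa', haa]
          · simp [syllableWeight]; omega
        | cons y ys =>
          by_cases hxy : x = y
          · subst hxy
            refine ⟨false, ys, t, ?_, ?_⟩
            · rw [eval_cons, hv]
              have hxx : ∀ g : G, gen x.toGen * (gen x.toGen * g) = g := fun g => by
                rw [← mul_assoc, gen_mul_self, one_mul]
              simp [aIf, syllables, haa', hxx, mul_assoc]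
            · simp [syllableWeight] at hw ⊢; omega
          · obtain ⟨z, hz, hzw⟩ := exists_third_letter x y hxy
            refine ⟨true, z :: ys, t, ?_, ?_⟩
            · simp [hv, aIf, syllables, haa', mul_assoc, ← hz]
            · simp [syllableWeight] at hw ⊢; omega
    cases s with
    | a =>
      refine ⟨!r, xs, t, ?_, ?_⟩
      · cases r <;> simp [hv, aIf, haa', mul_assoc]
      · cases r <;> simp [centiWeight] at hw ⊢ <;> omega
    | b => exact letter .b rfl
    | c => exact letter .c rfl
    | d => exact letter .d rfl

/-! ### Products of conjugates of `b, c, d` -/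

/-- The elements `x` (`Eb, Ec, Ed`) and `a x a` (`Ob, Oc, Od`) of `H`, for `x ∈ {b, c, d}`. -/
inductive Move : Type
  | Eb | Ec | Ed | Ob | Oc | Od

namespace Move

/-- The letter `x` of the move `x` or `a x a`. -/
def letter : Move → Gen
  | Eb | Ob => .b
  | Ec | Oc => .c
  | Ed | Od => .d

/-- Whether the move is `a x a`. -/
def odd : Move → Bool
  | Eb | Ec | Ed => false
  | Ob | Oc | Od => true

/-- Conjugation by `a`. -/
def swap : Move → Move
  | Eb => Ob | Ec => Oc | Ed => Od
  | Ob => Eb | Oc => Ec | Od => Ed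

/-- A word for the first coordinate of `ψ`. -/
def fstWord : Move → List Gen
  | Eb | Ec => [.a]
  | Ed => []
  | Ob => [.c]
  | Oc => [.d]
  | Od => [.b]

/-- A word for the second coordinate of `ψ`. -/
def sndWord (m : Move) : List Gen := m.swap.fstWord

/-- The weight of `x` plus that of `a`, in hundredths. -/
def cost (m : Move) : ℕ := 100 + centiWeight m.letter

theorem swap_swap (m : Move) : m.swap.swap = m := by cases m <;> rfl

theorem cost_swap (m : Move) : m.swap.cost = m.cost := by cases m <;> rfl

/-- The value of a move in `G`. -/
def toG (m : Move) : G := aIf m.odd * gen m.letter * aIf m.odd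

theorem toG_mem (m : Move) : m.toG ∈ H := by
  have hx : gen m.letter ∈ H := Subgroup.subset_normalClosure (by cases m <;> simp [letter])
  have : Subgroup.Normal H := Subgroup.normalClosure_normal
  cases h : m.odd
  · simpa [toG, h, aIf] using hx
  · have := this.conj_mem _ hx (gen .a)
    rw [gen_inv] at this
    simpa [toG, h, aIf] using this

/-- The value of a move in `H`. -/
def toH (m : Move) : H := ⟨m.toG, m.toG_mem⟩

theorem psi_toH (m : Move) : psi m.toH = (eval m.fstWord, eval m.sndWord) := by
  apply pairHom_injective
  rw [pairHom_psi]
  have conj : ∀ {s : Gen} {p : G × G}, pairHom p = genPerm s →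
      pairHom (p.2, p.1) = genPerm .a * (genPerm s * genPerm .a) := by
    intro s p hp
    rw [← hp, ← mul_assoc, genPerm_a_mul_pairHom, mul_assoc]
    have ha : genPerm .a * genPerm .a = 1 := congrArg Subtype.val (gen_mul_self .a)
    rw [ha, mul_one]
  cases m
  · simpa [toH, toG, aIf, odd, letter, fstWord, sndWord, swap, gen] using pairHom_b.symm
  · simpa [toH, toG, aIf, odd, letter, fstWord, sndWord, swap, gen] using pairHom_c.symm
  · simpa [toH, toG, aIf, odd, letter, fstWord, sndWord, swap, gen] using pairHom_d.symm
  · simpa [toH, toG, aIf, odd, letter, fstWord, sndWord, swap, gen, mul_assoc] using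
      (conj pairHom_b).symm
  · simpa [toH, toG, aIf, odd, letter, fstWord, sndWord, swap, gen, mul_assoc] using
      (conj pairHom_c).symm
  · simpa [toH, toG, aIf, odd, letter, fstWord, sndWord, swap, gen, mul_assoc] using
      (conj pairHom_d).symm

end Move

/-- The first coordinate of a product of moves. -/
def fstWords (L : List Move) : List Gen := L.flatMap Move.fstWord

/-- The second coordinate of a product of moves. -/
def sndWords (L : List Move) : List Gen := L.flatMap Move.sndWord

/-- The total cost of a list of moves. -/
def totalCost (L : List Move) : ℕ := (L.map Move.cost).sum

@[simp] theorem fstWords_append (L M : List Move) :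
    fstWords (L ++ M) = fstWords L ++ fstWords M := by simp [fstWords]

@[simp] theorem sndWords_append (L M : List Move) :
    sndWords (L ++ M) = sndWords L ++ sndWords M := by simp [sndWords]

@[simp] theorem totalCost_append (L M : List Move) :
    totalCost (L ++ M) = totalCost L + totalCost M := by simp [totalCost]

theorem fstWords_map_swap (L : List Move) : fstWords (L.map Move.swap) = sndWords L := by
  simp only [fstWords, sndWords, List.flatMap_map]; rfl

theorem sndWords_map_swap (L : List Move) : sndWords (L.map Move.swap) = fstWords L := by
  simp [fstWords, sndWords, List.flatMap_map, Move.sndWord, Move.swap_swap]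

theorem totalCost_map_swap (L : List Move) : totalCost (L.map Move.swap) = totalCost L := by
  simp [totalCost, Function.comp_def, Move.cost_swap]

theorem psi_prod_toH (L : List Move) :
    psi (L.map Move.toH).prod = (eval (fstWords L), eval (sndWords L)) := by
  induction L with
  | nil => simp [fstWords, sndWords, ← Prod.one_eq_mk]
  | cons m L ih => simp [ih, Move.psi_toH, fstWords, sndWords]

/-- A product of moves has a word of weight at most its cost plus the weight of `a`. -/
theorem exists_word_prod_toH (L : List Move) (r : Bool) :
    ∃ w : List Gen, eval w = aIf r * ((L.map Move.toH).prod : H) ∧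
      (w.map centiWeight).sum ≤ totalCost L + 100 := by
  induction L generalizing r with
  | nil =>
    cases r
    · exact ⟨[], by simp [aIf], by simp⟩
    · exact ⟨[.a], by simp [aIf], by simp [centiWeight]⟩
  | cons m L ih =>
    -- The closing `a` of an odd move is passed on to the tail; it cancels the opening `a` of a
    -- following odd move, so one `a` per move suffices.
    obtain ⟨w, hw, hc⟩ := ih m.odd
    have haa := gen_mul_self .a
    have haa' : ∀ g : G, gen .a * (gen .a * g) = g := fun g => by
      rw [← mul_assoc, haa, one_mul]
    by_cases h : r = m.odd
    · refine ⟨m.letter :: w, ?_, ?_⟩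
      · rw [eval_cons, hw, h]
        cases h' : m.odd <;> simp [Move.toH, Move.toG, h', aIf, haa', mul_assoc]
      · simp [totalCost, Move.cost] at hc ⊢; omega
    · refine ⟨.a :: m.letter :: w, ?_, ?_⟩
      · rw [eval_cons, eval_cons, hw]
        cases h' : m.odd <;> cases r <;>
          simp_all [Move.toH, Move.toG, aIf, mul_assoc]
      · simp [totalCost, Move.cost, centiWeight] at hc ⊢; omega

/-! ### Bounded remainders -/

/-- The elements of the dihedral group `⟨a, d⟩` of order `8`. -/
inductive Dih : Type
  | e | a | d | ad | da | ada | dad | adad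
  deriving DecidableEq

instance : Fintype Dih :=
  ⟨{.e, .a, .d, .ad, .da, .ada, .dad, .adad},
    by rintro (_ | _ | _ | _ | _ | _ | _ | _) <;> decide⟩

/-- A word for an element of `⟨a, d⟩`. -/
def Dih.word : Dih → List Gen
  | .e => []
  | .a => [.a]
  | .d => [.d]
  | .ad => [.a, .d]
  | .da => [.d, .a]
  | .ada => [.a, .d, .a]
  | .dad => [.d, .a, .d]
  | .adad => [.a, .d, .a, .d]

/-- The words of at most one syllable. -/
def shortWord : Option Letter → List Letter
  | none => []
  | some x => [x]

/-- The elements of `⟨a, d⟩` multiplied by at most one syllable. -/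
def remainders : Set G :=
  Set.range fun p : Dih × Option Letter => eval p.1.word * eval (syllables (shortWord p.2))

theorem remainders_finite : remainders.Finite := Set.finite_range _

theorem mem_remainders (r : Dih) {xs : List Letter} (h : xs.length ≤ 1) :
    eval r.word * eval (syllables xs) ∈ remainders := by
  match xs, h with
  | [], _ => exact ⟨(r, none), rfl⟩
  | [x], _ => exact ⟨(r, some x), rfl⟩

/-- The eight words exhaust `⟨a, d⟩`, since `(ad)⁴ = 1`; the finite multiplication table is checked
by the word-problem test. -/
theorem exists_dih_mul (s : Gen) (hs : s = .a ∨ s = .d) (r : Dih) :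
    ∃ r' : Dih, gen s * eval r.word = eval r'.word := by
  have key : ∀ r : Dih, (∃ r' : Dih, isTrivial 4 (.a :: (r.word ++ r'.word.reverse)) = true) ∧
      ∃ r' : Dih, isTrivial 4 (.d :: (r.word ++ r'.word.reverse)) = true := by decide +kernel
  have conclude : ∀ r' : Dih, isTrivial 4 (s :: (r.word ++ r'.word.reverse)) = true →
      gen s * eval r.word = eval r'.word := by
    intro r' h
    have := eval_eq_one_of_isTrivial h
    rw [eval_cons, eval_append, eval_reverse, ← mul_assoc] at this
    exact mul_inv_eq_one.mp this
  rcases hs with rfl | rfl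
  · obtain ⟨r', h⟩ := (key r).1; exact ⟨r', conclude r' h⟩
  · obtain ⟨r', h⟩ := (key r).2; exact ⟨r', conclude r' h⟩

theorem inv_eval_mul_mem_remainders {w : List Gen} (hw : ∀ s ∈ w, s = .a ∨ s = .d) {g : G}
    (hg : g ∈ remainders) : (eval w)⁻¹ * g ∈ remainders := by
  induction w generalizing g with
  | nil => simpa using hg
  | cons s w ih =>
    rw [eval_cons, mul_inv_rev, mul_assoc, gen_inv]
    refine ih (fun t ht => hw t (by simp [ht])) ?_
    obtain ⟨⟨r, o⟩, rfl⟩ := hg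
    obtain ⟨r', hr⟩ := exists_dih_mul s (hw s (by simp)) r
    exact ⟨(r', o), by simp only [← hr, mul_assoc]⟩

theorem eval_mul_eq_of_isTrivial {u v w z : List Gen}
    (h : isTrivial 8 (u.reverse ++ v ++ w ++ z.reverse) = true) :
    eval v * eval w = eval u * eval z := by
  have := eval_eq_one_of_isTrivial h
  simp only [eval_append, eval_reverse] at this
  rw [← eq_mul_inv_iff_mul_eq, one_mul, inv_inv, mul_assoc] at this
  rwa [← inv_mul_eq_iff_eq_mul]

/-- The bookkeeping of one rule: `p` is the old state, `q` the block consumed, `r` the output and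
`s` the new state; `t` and `u` are the remaining output and input. -/
theorem inv_mul_mul_mul_of_eq {p q r s : G} (h : p * q = r * s) (t u : G) :
    (r * t)⁻¹ * (p * (q * u)) = t⁻¹ * (s * u) := by
  rw [← mul_assoc p, h]; group

/-! ### Lifting one coordinate -/

/-- A rule `r · block = sndWords out · dst` for lifting the second coordinate, in which the first
coordinate stays in `⟨a, d⟩`. -/
structure SingleRow where
  block : List Letter
  dst : Dih
  out : List Move

/-- The rules, by the element of `⟨a, d⟩` to be carried over. -/
def singleTable : Dih → List SingleRow
  | .e =>
    [⟨[.b], .e, [.Oc, .Ed]⟩,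
      ⟨[.c], .d, [.Oc, .Ed]⟩,
      ⟨[.d], .ad, []⟩]
  | .a =>
    [⟨[.b], .e, [.Ed]⟩,
      ⟨[.c], .d, [.Ed]⟩,
      ⟨[.d], .d, []⟩]
  | .d =>
    [⟨[.d], .dad, []⟩,
      ⟨[.b], .e, [.Ec, .Oc, .Ed]⟩,
      ⟨[.c, .b], .e, [.Ec, .Oc, .Eb, .Oc, .Ed]⟩,
      ⟨[.c, .d], .dad, [.Ec, .Oc, .Ed]⟩,
      ⟨[.c, .c], .d, [.Ec, .Oc, .Eb, .Oc, .Ed]⟩]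
  | .ad =>
    [⟨[.d], .adad, []⟩,
      ⟨[.b], .e, [.Oc, .Ec, .Oc, .Ed]⟩,
      ⟨[.c, .b], .e, [.Oc, .Ec, .Oc, .Eb, .Oc, .Ed]⟩,
      ⟨[.c, .d], .dad, [.Oc, .Ec, .Oc, .Ed]⟩,
      ⟨[.c, .c], .d, [.Oc, .Ec, .Oc, .Eb, .Oc, .Ed]⟩]
  | .da =>
    [⟨[.b], .d, [.Ed]⟩,
      ⟨[.c], .e, [.Ed]⟩,
      ⟨[.d], .e, []⟩]
  | .ada =>
    [⟨[.d], .a, []⟩,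
      ⟨[.b], .d, [.Oc, .Ed]⟩,
      ⟨[.c], .e, [.Oc, .Ed]⟩]
  | .dad =>
    [⟨[.d], .ada, []⟩,
      ⟨[.c, .b], .e, [.Oc, .Ec, .Oc, .Ed, .Oc, .Ed]⟩,
      ⟨[.b, .b], .e, [.Oc, .Ec, .Oc, .Eb, .Oc, .Ed]⟩,
      ⟨[.c, .c], .d, [.Oc, .Ec, .Oc, .Ed, .Oc, .Ed]⟩,
      ⟨[.b, .d], .dad, [.Oc, .Ec, .Oc, .Ed]⟩,
      ⟨[.b, .c], .d, [.Oc, .Ec, .Oc, .Eb, .Oc, .Ed]⟩,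
      ⟨[.c, .d], .ad, [.Oc, .Ec, .Oc, .Ed]⟩]
  | .adad =>
    [⟨[.d], .da, []⟩,
      ⟨[.b], .d, [.Ec, .Oc, .Ed]⟩,
      ⟨[.c, .b], .e, [.Ec, .Oc, .Ed, .Oc, .Ed]⟩,
      ⟨[.c, .c], .d, [.Ec, .Oc, .Ed, .Oc, .Ed]⟩,
      ⟨[.c, .d], .ad, [.Ec, .Oc, .Ed]⟩]

/-- The potential of the elements carried over. -/
def singlePot : Dih → ℕ
  | .ad => 35780
  | .dad => 31498
  | _ => 0

/-- The rule is an identity in `G` whose cost is paid for by the potential and by `2.37` times the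
weight of the block. -/
def SingleRow.valid (r : Dih) (ρ : SingleRow) : Bool :=
  !ρ.block.isEmpty &&
  (fstWords ρ.out).all (fun s => s == .a || s == .d) &&
  isTrivial 8 ((sndWords ρ.out).reverse ++ r.word ++ syllables ρ.block ++ ρ.dst.word.reverse) &&
  Nat.ble (100 * totalCost ρ.out + singlePot ρ.dst)
    (singlePot r + 237 * syllableWeight ρ.block)

/-- The potentials are exactly the deficits of two rules: 35780 for `ad` with block `[.c, .c]`, and
31498 for `dad` with block `[.c, .d]`, which leads to `ad`. -/
theorem singleTable_valid :
    ∀ r : Dih, (singleTable r).all (SingleRow.valid r) = true := by decide +kernel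

/-- Two letters of lookahead always determine a rule, so reading stops only with at most one letter
left; hence the single syllable allowed in `remainders`. -/
theorem singleTable_covers (r : Dih) (x y : Letter) :
    ∃ ρ ∈ singleTable r, ρ.block.isPrefixOf [x, y] = true := by
  have key : ∀ (r : Dih) (x y : Letter),
      (singleTable r).any (fun ρ => ρ.block.isPrefixOf [x, y]) = true := by decide +kernel
  simpa only [List.any_eq_true] using key r x y

/-- The moves emitted have first coordinates in `⟨a, d⟩`, and `remainders` is stable under left
multiplication by that group, so the idle coordinate `g` never leaves it. -/
theorem exists_single_lift (ys : List Letter) (r : Dih) {g : G} (hg : g ∈ remainders) :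
    ∃ L : List Move,
      100 * totalCost L ≤ 237 * syllableWeight ys + singlePot r ∧
      (eval (fstWords L))⁻¹ * g ∈ remainders ∧
      (eval (sndWords L))⁻¹ * (eval r.word * eval (syllables ys)) ∈ remainders := by
  induction hn : ys.length using Nat.strong_induction_on generalizing ys r g with
  | _ n ih =>
    match ys, hn with
    | [], _ => exact ⟨[], by simp [totalCost], by simpa [fstWords] using hg,
        by simpa [sndWords] using mem_remainders r (xs := []) (by simp)⟩
    | [y], _ => exact ⟨[], by simp [totalCost], by simpa [fstWords] using hg,
        by simpa [sndWords] using mem_remainders r (xs := [y]) (by simp)⟩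
    | y₁ :: y₂ :: zs, hn =>
      obtain ⟨ρ, hρ, hpre⟩ := singleTable_covers r y₁ y₂
      have hvalid := List.all_eq_true.mp (singleTable_valid r) ρ hρ
      simp only [SingleRow.valid, Bool.and_eq_true, Bool.not_eq_true', List.all_eq_true,
        Bool.or_eq_true, beq_iff_eq, Nat.ble_eq] at hvalid
      obtain ⟨⟨⟨hne, hfst⟩, htriv⟩, hcost⟩ := hvalid
      obtain ⟨rest, hrest⟩ := List.isPrefixOf_iff_prefix.mp hpre
      have hsplit : y₁ :: y₂ :: zs = ρ.block ++ (rest ++ zs) := by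
        rw [← List.append_assoc, hrest]; rfl
      have hlen : (rest ++ zs).length < n := by
        have h₁ := congrArg List.length hsplit
        have h₂ : 0 < ρ.block.length := List.length_pos_of_ne_nil (by
          intro h; simp [h] at hne)
        simp only [List.length_append] at h₁ ⊢
        omega
      obtain ⟨L, hL, h₀, h₁⟩ := ih _ hlen (rest ++ zs) ρ.dst
        (inv_eval_mul_mem_remainders hfst hg) rfl
      refine ⟨ρ.out ++ L, ?_, ?_, ?_⟩
      · rw [hsplit, syllableWeight_append, totalCost_append]
        omega
      · rwa [fstWords_append, eval_append, mul_inv_rev, mul_assoc]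
      · rwa [hsplit, syllables_append, eval_append, sndWords_append, eval_append,
          inv_mul_mul_mul_of_eq (eval_mul_eq_of_isTrivial htriv)]

/-! ### Lifting both coordinates -/

/-- A rule `(s.1 · fstBlock, s.2 · sndBlock) = (fstWords out · dst.1, sndWords out · dst.2)`. -/
structure PairRow where
  fstBlock : List Letter
  sndBlock : List Letter
  dst : Dih × Dih
  out : List Move

/-- The rule with the coordinates exchanged. -/
def PairRow.swap (ρ : PairRow) : PairRow :=
  ⟨ρ.sndBlock, ρ.fstBlock, ρ.dst.swap, ρ.out.map Move.swap⟩

/-- The rules, by the pair of elements of `⟨a, d⟩` to be carried over, up to exchange of the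
coordinates. -/
def pairTable : Dih × Dih → List PairRow
  | (.e, .e) =>
    [⟨[], [.b, .b], (.e, .e), [.Oc, .Ed, .Oc, .Ed]⟩,
      ⟨[], [.d], (.e, .ad), []⟩,
      ⟨[.b, .c], [.c], (.a, .e), [.Ec, .Od, .Ec, .Ob, .Eb]⟩,
      ⟨[.b, .d], [.c], (.a, .e), [.Ec, .Od, .Ec, .Oc, .Eb]⟩,
      ⟨[.b], [.b, .c], (.e, .e), [.Oc, .Ed, .Oc, .Eb, .Od]⟩,
      ⟨[.c, .b], [.c, .d], (.e, .a), [.Oc, .Ed, .Oc, .Ec, .Ob, .Ec, .Od]⟩,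
      ⟨[.b, .d], [.b, .d], (.e, .ad), [.Ec, .Od, .Ec, .Oc, .Ed]⟩,
      ⟨[.c, .c], [.c, .c], (.e, .e), [.Ec, .Od, .Ec, .Oc, .Eb, .Oc, .Eb, .Od]⟩,
      ⟨[.c], [.c, .d], (.d, .ada), [.Oc, .Ed, .Oc, .Ec, .Od]⟩,
      ⟨[.c, .b], [.c, .c], (.d, .e), [.Ec, .Od, .Ec, .Oc, .Eb, .Oc, .Eb, .Od]⟩,
      ⟨[.c, .b], [.c, .b], (.d, .d), [.Ec, .Od, .Ec, .Oc, .Eb, .Oc, .Eb, .Od]⟩]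
  | (.e, .a) =>
    [⟨[], [.b], (.e, .e), [.Ed]⟩,
      ⟨[], [.c], (.e, .d), [.Ed]⟩,
      ⟨[], [.d], (.e, .d), []⟩]
  | (.a, .a) =>
    [⟨[], [.b], (.a, .e), [.Ed]⟩,
      ⟨[], [.c], (.e, .e), [.Eb]⟩,
      ⟨[.d], [.d], (.d, .d), []⟩]
  | (.e, .ad) =>
    [⟨[.c], [.d], (.d, .ada), [.Ec, .Od]⟩,
      ⟨[.d], [.d], (.d, .ada), [.Ec]⟩,
      ⟨[.b, .b], [], (.e, .ad), [.Ec, .Od, .Ec, .Od]⟩,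
      ⟨[.d, .d], [], (.ada, .d), [.Oc]⟩,
      ⟨[.b], [], (.e, .dad), [.Ec, .Od]⟩,
      ⟨[.c, .c], [.b], (.e, .d), [.Ec, .Ob, .Ec, .Ob, .Ed]⟩,
      ⟨[.c, .b], [.c], (.d, .e), [.Ec, .Ob, .Ec, .Ob, .Ed]⟩,
      ⟨[.c, .c], [.c], (.e, .e), [.Ec, .Ob, .Ec, .Ob, .Ed]⟩,
      ⟨[.c, .b], [.b], (.d, .d), [.Ec, .Ob, .Ec, .Ob, .Ed]⟩,
      ⟨[.c, .d], [.b], (.e, .d), [.Ec, .Ob, .Ec, .Oc, .Ed]⟩,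
      ⟨[.d, .c], [.b], (.e, .d), [.Ec, .Oc, .Ec, .Ob, .Ed]⟩,
      ⟨[.d, .b], [.c], (.d, .e), [.Ec, .Oc, .Ec, .Ob, .Ed]⟩,
      ⟨[.c, .d], [.c], (.e, .e), [.Ec, .Ob, .Ec, .Oc, .Ed]⟩,
      ⟨[.d, .c], [.c], (.e, .e), [.Ec, .Oc, .Ec, .Ob, .Ed]⟩,
      ⟨[.d, .b], [.b], (.d, .d), [.Ec, .Oc, .Ec, .Ob, .Ed]⟩]
  | (.d, .ada) =>
    [⟨[], [.b], (.e, .d), [.Oc, .Ed]⟩,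
      ⟨[], [.d, .b], (.d, .e), [.Ed]⟩,
      ⟨[.b], [.c], (.e, .d), [.Oc, .Eb, .Od]⟩,
      ⟨[], [.d, .c], (.d, .d), [.Ed]⟩,
      ⟨[], [.d, .d], (.d, .d), []⟩,
      ⟨[.d], [.c], (.ad, .e), [.Oc, .Ed]⟩,
      ⟨[.c], [.c], (.d, .d), [.Oc, .Eb, .Od]⟩]
  | (.e, .d) =>
    [⟨[], [.d], (.e, .dad), []⟩,
      ⟨[.b], [], (.e, .e), [.Ec, .Od]⟩,
      ⟨[.c], [.b], (.e, .e), [.Ec, .Ob, .Ed]⟩,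
      ⟨[.c], [.c], (.e, .d), [.Ec, .Ob, .Ed]⟩,
      ⟨[.d], [.b], (.e, .e), [.Ec, .Oc, .Ed]⟩,
      ⟨[.d], [.c], (.e, .d), [.Ec, .Oc, .Ed]⟩]
  | (.d, .d) =>
    [⟨[.c], [.d], (.d, .ada), [.Oc, .Ec, .Od]⟩,
      ⟨[], [.d, .d], (.d, .ada), []⟩,
      ⟨[.b], [.d, .c], (.d, .e), [.Oc, .Ec, .Ob, .Ed]⟩,
      ⟨[.b], [.d, .b], (.d, .d), [.Oc, .Ec, .Ob, .Ed]⟩,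
      ⟨[.b], [.c, .c], (.d, .e), [.Ec, .Oc, .Eb, .Oc, .Eb, .Od]⟩,
      ⟨[.b], [.c, .b], (.d, .d), [.Ec, .Oc, .Eb, .Oc, .Eb, .Od]⟩,
      ⟨[.b], [.c, .d], (.d, .e), [.Ec, .Oc, .Eb, .Oc, .Ec, .Od]⟩,
      ⟨[.c], [.c, .b], (.e, .d), [.Ec, .Oc, .Eb, .Oc, .Eb, .Od]⟩,
      ⟨[.b], [.b, .d], (.d, .ada), [.Ec, .Oc, .Eb, .Oc, .Ec, .Od]⟩,
      ⟨[.d], [.d], (.d, .ada), [.Oc, .Ec]⟩,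
      ⟨[.c], [.c, .c], (.e, .e), [.Ec, .Oc, .Eb, .Oc, .Eb, .Od]⟩,
      ⟨[.b, .b], [.b, .c], (.e, .a), [.Ec, .Oc, .Ed, .Oc, .Eb, .Oc, .Ec, .Od, .Ec, .Od]⟩,
      ⟨[.c, .d], [.c, .d], (.e, .ad), [.Oc, .Ec, .Ob, .Ec, .Oc, .Ed]⟩,
      ⟨[.b, .b], [.b, .b], (.e, .ad), [.Ec, .Oc, .Ed, .Oc, .Eb, .Oc, .Ec, .Od, .Ec, .Od]⟩,
      ⟨[.b, .c], [.b, .c], (.a, .d), [.Oc, .Ec, .Od, .Ec, .Ob, .Ec, .Oc, .Ed, .Oc, .Ed]⟩]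
  | (.e, .dad) =>
    [⟨[.b], [], (.e, .ad), [.Ec, .Od]⟩,
      ⟨[.c], [.d], (.e, .dad), [.Ec, .Ob]⟩,
      ⟨[.d], [.d], (.e, .dad), [.Ec, .Oc]⟩,
      ⟨[.c, .b], [.b], (.d, .e), [.Ec, .Ob, .Ec, .Ob, .Ed]⟩,
      ⟨[.c, .c], [.b], (.e, .e), [.Ec, .Ob, .Ec, .Ob, .Ed]⟩,
      ⟨[.d, .d], [.b], (.a, .d), [.Oc, .Ec, .Oc, .Ed]⟩,
      ⟨[.d, .b], [.b], (.d, .e), [.Ec, .Oc, .Ec, .Ob, .Ed]⟩,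
      ⟨[.c, .c], [.c], (.e, .d), [.Ec, .Ob, .Ec, .Ob, .Ed]⟩,
      ⟨[.d, .d], [.c], (.a, .e), [.Oc, .Ec, .Oc, .Ed]⟩,
      ⟨[.c, .d], [.b], (.e, .e), [.Ec, .Ob, .Ec, .Oc, .Ed]⟩,
      ⟨[.d, .c], [.b], (.e, .e), [.Ec, .Oc, .Ec, .Ob, .Ed]⟩,
      ⟨[.c, .b], [.c], (.d, .d), [.Ec, .Ob, .Ec, .Ob, .Ed]⟩,
      ⟨[.c, .d], [.c], (.e, .d), [.Ec, .Ob, .Ec, .Oc, .Ed]⟩,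
      ⟨[.d, .c], [.c], (.e, .d), [.Ec, .Oc, .Ec, .Ob, .Ed]⟩,
      ⟨[.d, .b], [.c, .b], (.dad, .e), [.Ec, .Oc, .Ec, .Ob, .Eb, .Oc, .Ed]⟩,
      ⟨[.d, .b], [.c, .d], (.e, .adad), [.Oc, .Ec, .Oc, .Eb, .Ob]⟩,
      ⟨[.d, .b], [.c, .c], (.adad, .e), [.Ec, .Oc, .Ec, .Ob, .Eb, .Oc, .Eb]⟩]
  | (.a, .d) =>
    [⟨[.b], [], (.e, .d), [.Od]⟩,
      ⟨[.c], [], (.d, .d), [.Od]⟩,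
      ⟨[.d], [], (.d, .d), []⟩]
  | (.e, .adad) =>
    [⟨[], [.d, .b], (.e, .d), [.Ed]⟩,
      ⟨[], [.d, .c], (.e, .e), [.Ed]⟩,
      ⟨[], [.d, .d], (.e, .e), []⟩,
      ⟨[.b], [.c], (.d, .e), [.Ec, .Ob, .Ed]⟩,
      ⟨[.c], [.b], (.e, .d), [.Ec, .Ob, .Ed]⟩,
      ⟨[.c], [.c], (.e, .e), [.Ec, .Ob, .Ed]⟩,
      ⟨[.b], [.b], (.d, .d), [.Ec, .Ob, .Ed]⟩,
      ⟨[.d], [.b], (.e, .d), [.Ec, .Oc, .Ed]⟩,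
      ⟨[.d], [.c], (.e, .e), [.Ec, .Oc, .Ed]⟩]
  | _ => []

/-- The rules, by the pair of elements of `⟨a, d⟩` to be carried over. -/
def pairRules (s : Dih × Dih) : List PairRow :=
  pairTable s ++ (pairTable s.swap).map PairRow.swap

/-- The pairs of elements of `⟨a, d⟩` that are carried over. -/
def pairStates : List (Dih × Dih) :=
  [(.e, .e), (.e, .a), (.a, .a), (.e, .ad), (.d, .ada), (.e, .d), (.d, .d), (.e, .dad), (.a, .d),
    (.e, .adad), (.a, .e), (.ad, .e), (.ada, .d), (.d, .e), (.dad, .e), (.d, .a), (.adad, .e)]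

/-- The potential of the pairs carried over. -/
def pairPot : Dih × Dih → ℕ
  | (.e, .ad) | (.ad, .e) => 14879
  | (.e, .dad) | (.dad, .e) => 19497
  | (.d, .d) => 27723
  | _ => 0

/-- The rule is an identity in `G × G` whose cost is paid for by the potential and by the weights
of the blocks, one of them counted `1.46` times and the other `2.37` times. -/
def PairRow.valid (s : Dih × Dih) (ρ : PairRow) : Bool :=
  !(ρ.fstBlock ++ ρ.sndBlock).isEmpty &&
  isTrivial 8
    ((fstWords ρ.out).reverse ++ s.1.word ++ syllables ρ.fstBlock ++ ρ.dst.1.word.reverse) &&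
  isTrivial 8
    ((sndWords ρ.out).reverse ++ s.2.word ++ syllables ρ.sndBlock ++ ρ.dst.2.word.reverse) &&
  Nat.ble (100 * totalCost ρ.out + pairPot ρ.dst)
    (pairPot s + (146 * syllableWeight ρ.fstBlock + 237 * syllableWeight ρ.sndBlock)) &&
  Nat.ble (100 * totalCost ρ.out + pairPot ρ.dst)
    (pairPot s + (237 * syllableWeight ρ.fstBlock + 146 * syllableWeight ρ.sndBlock)) &&
  pairStates.contains ρ.dst

/-- Each nonzero potential is the exact deficit of a rule: `(.e, .ad)` with blocks `[.b], []`, `(.e,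
.dad)` with `[.d, .b], [.c, .c]`, and `(.d, .d)` with `[.b], [.c, .d]`. -/
theorem pairRules_valid :
    ∀ s ∈ pairStates, (pairRules s).all (PairRow.valid s) = true := by decide +kernel

theorem pairRules_covers {s : Dih × Dih} (hs : s ∈ pairStates) (x₁ x₂ y₁ y₂ : Letter) :
    ∃ ρ ∈ pairRules s,
      ρ.fstBlock.isPrefixOf [x₁, x₂] = true ∧ ρ.sndBlock.isPrefixOf [y₁, y₂] = true := by
  have key : ∀ s ∈ pairStates, ∀ x₁ x₂ y₁ y₂ : Letter, (pairRules s).any (fun ρ =>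
      ρ.fstBlock.isPrefixOf [x₁, x₂] && ρ.sndBlock.isPrefixOf [y₁, y₂]) = true := by
    decide +kernel
  simpa only [List.any_eq_true, Bool.and_eq_true] using key s hs x₁ x₂ y₁ y₂

theorem singlePot_le (r : Dih) : singlePot r ≤ 35780 := by
  cases r <;> simp [singlePot]

/-- The bound for the cost of lifting words of weights `m` and `n`. -/
def liftBound (m n : ℕ) : ℕ := max (146 * m + 237 * n) (237 * m + 146 * n)

/-- Both cost inequalities of the rules are accumulated until one word is nearly spent. The tail of
the other costs 2.37 per unit weight, which fits the term of `liftBound` giving that word the higher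
rate; 35780 covers `singlePot` at the change of regime. -/
theorem exists_pair_lift (xs ys : List Letter) {s : Dih × Dih} (hs : s ∈ pairStates) :
    ∃ L : List Move,
      100 * totalCost L ≤
        liftBound (syllableWeight xs) (syllableWeight ys) + pairPot s + 35780 ∧
      (eval (fstWords L))⁻¹ * (eval s.1.word * eval (syllables xs)) ∈ remainders ∧
      (eval (sndWords L))⁻¹ * (eval s.2.word * eval (syllables ys)) ∈ remainders := by
  induction hn : xs.length + ys.length using Nat.strong_induction_on generalizing xs ys s with
  | _ n ih =>
    by_cases hx : xs.length ≤ 1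
    · obtain ⟨L, hL, h₀, h₁⟩ := exists_single_lift ys s.2 (mem_remainders s.1 hx)
      refine ⟨L, ?_, h₀, h₁⟩
      have := singlePot_le s.2
      simp only [liftBound]
      omega
    by_cases hy : ys.length ≤ 1
    · obtain ⟨L, hL, h₀, h₁⟩ := exists_single_lift xs s.1 (mem_remainders s.2 hy)
      refine ⟨L.map Move.swap, ?_, ?_, ?_⟩
      · have := singlePot_le s.1
        rw [totalCost_map_swap]
        simp only [liftBound]
        omega
      · rwa [fstWords_map_swap]
      · rwa [sndWords_map_swap]
    match xs, ys, hn, hx, hy with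
    | [], _, _, hx, _ | [_], _, _, hx, _ => simp at hx
    | _, [], _, _, hy | _, [_], _, _, hy => simp at hy
    | x₁ :: x₂ :: us, y₁ :: y₂ :: vs, hn, _, _ =>
      obtain ⟨ρ, hρ, hpx, hpy⟩ := pairRules_covers hs x₁ x₂ y₁ y₂
      have hvalid := List.all_eq_true.mp (pairRules_valid s hs) ρ hρ
      simp only [PairRow.valid, Bool.and_eq_true, Bool.not_eq_true', Nat.ble_eq,
        List.contains_iff_mem] at hvalid
      obtain ⟨⟨⟨⟨⟨hne, ht₀⟩, ht₁⟩, hc₀⟩, hc₁⟩, hdst⟩ := hvalid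
      obtain ⟨p, hp⟩ := List.isPrefixOf_iff_prefix.mp hpx
      obtain ⟨q, hq⟩ := List.isPrefixOf_iff_prefix.mp hpy
      have hxs : x₁ :: x₂ :: us = ρ.fstBlock ++ (p ++ us) := by
        rw [← List.append_assoc, hp]; rfl
      have hys : y₁ :: y₂ :: vs = ρ.sndBlock ++ (q ++ vs) := by
        rw [← List.append_assoc, hq]; rfl
      have hlen : (p ++ us).length + (q ++ vs).length < n := by
        have h₁ := congrArg List.length hxs
        have h₂ := congrArg List.length hys
        have h₃ : 0 < (ρ.fstBlock ++ ρ.sndBlock).length := List.length_pos_of_ne_nil (by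
          intro h; simp [h] at hne)
        simp only [List.length_append] at h₁ h₂ h₃ ⊢
        omega
      obtain ⟨L, hL, h₀, h₁⟩ := ih _ hlen (p ++ us) (q ++ vs) hdst rfl
      refine ⟨ρ.out ++ L, ?_, ?_, ?_⟩
      · rw [hxs, hys, syllableWeight_append ρ.fstBlock, syllableWeight_append ρ.sndBlock,
          totalCost_append]
        -- Each term of the maximum grows by one of the two costs `hc₀`, `hc₁`, so the rule is paid
        -- for whichever term is the larger.
        simp only [liftBound] at hL ⊢
        omega
      · rwa [hxs, syllables_append, eval_append, fstWords_append, eval_append,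
          inv_mul_mul_mul_of_eq (eval_mul_eq_of_isTrivial ht₀)]
      · rwa [hys, syllables_append, eval_append, sndWords_append, eval_append,
          inv_mul_mul_mul_of_eq (eval_mul_eq_of_isTrivial ht₁)]

/-! ### The norm -/

/-- The weight `ω(a) = 1`, `ω(b) = 3.33`, `ω(c) = 2.8`, `ω(d) = 1.06`. -/
noncomputable def weight (s : Gen) : ℝ := centiWeight s / 100

theorem isWeight_weight : IsWeight weight := by
  intro s; cases s <;> norm_num [weight, centiWeight]

theorem wordWeight_weight (w : List Gen) :
    wordWeight weight w = ((w.map centiWeight).sum : ℕ) / 100 := by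
  induction w with
  | nil => simp [wordWeight]
  | cons s w ih =>
    simp only [wordWeight, weight, List.map_cons, List.sum_cons] at ih ⊢
    push_cast at ih ⊢
    rw [ih]; ring

theorem partialNorm_eval_le {ω : Gen → ℝ} (hω : IsWeight ω) (w : List Gen) :
    partialNorm ω (eval w) ≤ wordWeight ω w :=
  (isLeast_partial hω (eval w)).2 ⟨w, rfl, rfl⟩

theorem exists_word_eq_partialNorm {ω : Gen → ℝ} (hω : IsWeight ω) (g : G) :
    ∃ w, eval w = g ∧ wordWeight ω w = partialNorm ω g :=
  (isLeast_partial hω g).1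

theorem partialNorm_mul_le {ω : Gen → ℝ} (hω : IsWeight ω) (g k : G) :
    partialNorm ω (g * k) ≤ partialNorm ω g + partialNorm ω k := by
  obtain ⟨u, rfl, hu⟩ := exists_word_eq_partialNorm hω g
  obtain ⟨v, rfl, hv⟩ := exists_word_eq_partialNorm hω k
  rw [← eval_append, ← hu, ← hv]
  refine (partialNorm_eval_le hω _).trans_eq ?_
  simp [wordWeight]

theorem exists_syllables_eq (g : G) :
    ∃ (r : Bool) (xs : List Letter) (t : Bool),
      g = aIf r * eval (syllables xs) * aIf t ∧
      (syllableWeight xs : ℝ) ≤ 100 * partialNorm weight g + 100 := by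
  obtain ⟨w, rfl, hw⟩ := exists_word_eq_partialNorm isWeight_weight g
  obtain ⟨r, xs, t, he, hx⟩ := exists_syllables w
  refine ⟨r, xs, t, he, ?_⟩
  rw [← hw, wordWeight_weight]
  have : syllableWeight xs ≤ (w.map centiWeight).sum + 100 := by
    refine hx.trans ?_
    split <;> omega
  have : (syllableWeight xs : ℝ) ≤ ((w.map centiWeight).sum : ℕ) + 100 := by exact_mod_cast this
  linarith

/-- The remainders multiplied by `1` or `a`. -/
def finalRemainders : Set G := Set.image2 (fun g t => g * aIf t) remainders Set.univ

theorem finalRemainders_finite : finalRemainders.Finite :=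
  remainders_finite.image2 _ Set.finite_univ

/-- `1` or `a` as an element of `⟨a, d⟩`. -/
def Dih.aIf (r : Bool) : Dih := if r then .a else .e

theorem Dih.eval_aIf (r : Bool) : eval (Dih.aIf r).word = Grigorchuk.aIf r := by
  cases r <;> simp [Dih.aIf, Dih.word, Grigorchuk.aIf]

/-- Every element of `H` is a product of moves, of cost controlled by the coordinates of `ψ`, and
of an element with coordinates in a finite set. -/
theorem exists_moves (h : H) :
    ∃ L : List Move,
      (totalCost L : ℝ) ≤ 383 * max (partialNorm weight (psi h).1) (partialNorm weight (psi h).2)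
        + 1000 ∧
      (psi ((L.map Move.toH).prod⁻¹ * h)).1 ∈ finalRemainders ∧
      (psi ((L.map Move.toH).prod⁻¹ * h)).2 ∈ finalRemainders := by
  obtain ⟨r, xs, t, hg, hx⟩ := exists_syllables_eq (psi h).1
  obtain ⟨r', ys, t', hg', hy⟩ := exists_syllables_eq (psi h).2
  have hs : ∀ r r' : Bool, (Dih.aIf r, Dih.aIf r') ∈ pairStates ∧
      pairPot (Dih.aIf r, Dih.aIf r') = 0 := by decide
  obtain ⟨L, hL, h₀, h₁⟩ := exists_pair_lift xs ys (hs r r').1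
  rw [(hs r r').2] at hL
  refine ⟨L, ?_, ?_, ?_⟩
  · set m := max (partialNorm weight (psi h).1) (partialNorm weight (psi h).2)
    have h₁m : partialNorm weight (psi h).1 ≤ m := le_max_left _ _
    have h₂m : partialNorm weight (psi h).2 ≤ m := le_max_right _ _
    -- Here 383 = 146 + 237, and the inner 100 is the possible extra `a` in normalizing a word.
    have hb : (liftBound (syllableWeight xs) (syllableWeight ys) : ℝ) ≤
        383 * (100 * m + 100) := by
      simp only [liftBound]
      push_cast
      exact max_le (by linarith) (by linarith)
    have hL' : (100 * totalCost L : ℝ) ≤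
        liftBound (syllableWeight xs) (syllableWeight ys) + 0 + 35780 := by exact_mod_cast hL
    -- After division by 100 the constant is 383 + 357.8, below 1000.
    linarith
  · rw [map_mul, map_inv, psi_prod_toH]
    refine ⟨_, h₀, t, Set.mem_univ _, ?_⟩
    simp only [Prod.fst_mul, Prod.fst_inv, hg, Dih.eval_aIf, mul_assoc]
  · rw [map_mul, map_inv, psi_prod_toH]
    refine ⟨_, h₁, t', Set.mem_univ _, ?_⟩
    simp only [Prod.snd_mul, Prod.snd_inv, hg', Dih.eval_aIf, mul_assoc]

/-- The norm is bounded on the elements of `H` with coordinates in a finite set. -/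
theorem exists_bound_of_finite {A : Set G} (hA : A.Finite) :
    ∃ C : ℝ, 0 ≤ C ∧ ∀ h : H, (psi h).1 ∈ A → (psi h).2 ∈ A → partialNorm weight h ≤ C := by
  have hfin : {h : H | (psi h).1 ∈ A ∧ (psi h).2 ∈ A}.Finite :=
    (hA.prod hA).preimage psi_injective.injOn
  obtain ⟨C, hC⟩ := (hfin.image fun h : H => partialNorm weight (h : G)).bddAbove
  exact ⟨max C 0, le_max_right _ _, fun h h₀ h₁ =>
    (hC ⟨h, ⟨h₀, h₁⟩, rfl⟩).trans (le_max_left _ _)⟩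

theorem partialNorm_nonneg {ω : Gen → ℝ} (hω : IsWeight ω) (g : G) : 0 ≤ partialNorm ω g := by
  obtain ⟨w, -, hw⟩ := exists_word_eq_partialNorm hω g
  rw [← hw]
  exact List.sum_nonneg (by simpa using fun s _ => (hω s).le)

theorem partialNorm_prod_toH_le (L : List Move) :
    partialNorm weight ((L.map Move.toH).prod : H) ≤ totalCost L / 100 + 1 := by
  obtain ⟨w, hw, hc⟩ := exists_word_prod_toH L false
  have : eval w = ((L.map Move.toH).prod : H) := by simpa [aIf] using hw
  rw [← this]
  refine (partialNorm_eval_le isWeight_weight w).trans ?_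
  rw [wordWeight_weight]
  have : (((w.map centiWeight).sum : ℕ) : ℝ) ≤ totalCost L + 100 := by exact_mod_cast hc
  linarith

end Grigorchuk

theorem mainTheorem2 :
    ∃ (ω : Grigorchuk.Gen → ℝ) (η K : ℝ),
      Grigorchuk.IsWeight ω ∧ Grigorchuk.IsTriangular ω ∧
      ω .a = 1 ∧ ω .b = 3.33 ∧ ω .c = 2.8 ∧ ω .d = 1.06 ∧
      η = 3.83414 ∧ η < 4 ∧ 0 ≤ K ∧
      ∀ h : Grigorchuk.H,
        Grigorchuk.partialNorm ω (h : Grigorchuk.G) ≤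
          η * max (Grigorchuk.partialNorm ω (Grigorchuk.psi h).1)
            (Grigorchuk.partialNorm ω (Grigorchuk.psi h).2) + K := by
  open Grigorchuk in
  obtain ⟨C, hC, hbound⟩ := exists_bound_of_finite finalRemainders_finite
  -- `C` bounds the remainder, 10 is the constant 1000 of `exists_moves` in hundredths, and 1 is the
  -- possible extra `a` in writing out the moves.
  refine ⟨weight, 3.83414, C + 11, isWeight_weight, ?_, ?_, ?_, ?_, ?_, rfl, ?_, ?_, ?_⟩
  · norm_num [IsTriangular, weight, centiWeight]
  · norm_num [weight, centiWeight]
  · norm_num [weight, centiWeight]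
  · norm_num [weight, centiWeight]
  · norm_num [weight, centiWeight]
  · norm_num
  · linarith
  · intro h
    obtain ⟨L, hL, h₀, h₁⟩ := exists_moves h
    have hrem := hbound _ h₀ h₁
    have hprod := partialNorm_prod_toH_le L
    have hmul := partialNorm_mul_le isWeight_weight ((L.map Move.toH).prod : H)
      (((L.map Move.toH).prod⁻¹ * h : H) : G)
    rw [← Subgroup.coe_mul, mul_inv_cancel_left] at hmul
    -- The argument yields the rate 3.83; nonnegativity of the maximum permits weakening it to
    -- 3.83414.
    have hm : 0 ≤ max (partialNorm weight (psi h).1) (partialNorm weight (psi h).2) :=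
      (partialNorm_nonneg isWeight_weight _).trans (le_max_left _ _)
    linarith
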